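/- For non-negative integers $a$ and $n$, let $$MO(a;n):=\sum s_1s_2\cdots s_a,$$ where the sum runs over all partitions $n=s_1k_1+s_2k_2+\cdots+s_ak_a$ of $n$ with exactly $a$ distinct part sizes $0<k_1<k_2<\cdots<k_a$, the part $k_i$ having multiplicity $s_i\ge 1$. Equivalently, $$\sum_{n\ge 0}MO(a;n)\,q^n=\sum_{0<k_1<k_2<\cdots<k_a}\frac{q^{k_1+k_2+\cdots+k_a}}{(1-q^{k_1})^2(1-q^{k_2})^2\cdots(1-q^{k_a})^2}.$$ Then for every non-negative integer $n$, $$MO(10;11n+7)\equiv 0\pmod{11}.$$ -/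

import Mathlib

/-- MacMahon's `MO(a; n)`: the sum, over the partitions of `n` with exactly `a` distinct part sizes
`0 < k₁ < ⋯ < k_a`, of the product `s₁ s₂ ⋯ s_a` of the multiplicities of these part sizes.
(A `Nat.Partition n` is a multiset of positive integers with sum `n`.) -/
def MO (a n : ℕ) : ℕ :=
  ∑ p : Nat.Partition n with p.parts.toFinset.card = a,
    ∏ k ∈ p.parts.toFinset, p.parts.count k

/-! Let `E = ∏ (1 - q^k)`, and let `G` be the generating function of `MO 10` modulo 11. Then `G =
E^8 * E^(-11) * (E^3 * G)`. Modulo 11 the last two factors are series in `q^11`, so it suffices that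
`E^8` has no terms of exponent 7 modulo 11.

For `E^3 * G`: mark part sizes by `w = 2 - z - z⁻¹`. The Jacobi triple product turns `E^3` times the
generating function into `∑ (-1)^n q^(n(n+1)/2) (z^(-n) + ⋯ + z^n)`
(`coeff_genFun_mul_pentagonalSeries`). The coefficient of `w^10` in the weight is a sum of two
binomials, which by Lucas vanish modulo 11 unless 11 divides `n(n+1)/2` (`coeff_ten_tripleWeight`).

For `E^8`: Jacobi's formula for `E^3` makes `-2 E^9` a sum over `ℤ³` whose weight depends only on
differences `a`, `b` (`hasSum_pentagonalSeries_pow_nine`). Each line of diagonal translates sums to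
zero or, by the pentagonal number theorem, to `E` times a monomial `± a^2 b q^N` with `3N + 1 = a^2
- ab + b^2`. If `N ≡ 7`, this norm vanishes modulo 11, which forces `11 ∣ a`. -/

open PowerSeries Finset Filter Topology
open scoped PowerSeries.WithPiTopology

/-! ### Triangular numbers -/

/-- The triangular number `k (k + 1) / 2`, for an integer `k`. -/
def tri (k : ℤ) : ℕ := (k * (k + 1) / 2).toNat

theorem two_mul_tri (k : ℤ) : 2 * (tri k : ℤ) = k * (k + 1) := by
  have h : 2 ∣ k * (k + 1) := (Int.even_mul_succ_self k).two_dvd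
  have h0 : 0 ≤ k * (k + 1) := by
    rcases le_or_gt 0 k with hk | hk
    · positivity
    · exact mul_nonneg_of_nonpos_of_nonpos (by lia) (by lia)
  rw [tri, Int.toNat_of_nonneg (by lia)]
  lia

theorem tri_add_one (n : ℕ) : tri (n + 1) = tri n + (n + 1) := by
  have h1 := two_mul_tri n
  have h2 := two_mul_tri (n + 1)
  zify
  linarith

theorem tri_neg_add_one (k : ℤ) : tri (-(k + 1)) = tri k := by
  have h1 := two_mul_tri k
  have h2 := two_mul_tri (-(k + 1))
  zify
  linarith

theorem le_tri (n : ℕ) : n ≤ tri n := by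
  have h1 := two_mul_tri n
  zify
  nlinarith

theorem natAbs_le_tri_add_one (k : ℤ) : k.natAbs ≤ tri k + 1 := by
  rcases le_or_gt 0 k with hk | hk
  · obtain ⟨n, rfl⟩ := Int.eq_ofNat_of_zero_le hk
    have := le_tri n
    simp only [Int.natAbs_natCast]
    lia
  · obtain ⟨n, rfl⟩ := Int.eq_negSucc_of_lt_zero hk
    have := le_tri n
    rw [Int.negSucc_eq, tri_neg_add_one]
    lia

/-! ### The finite Jacobi triple product -/

section Finite
variable (R : Type*) [CommRing R]

/-- The finite product `(1 - q) (1 - q ^ 2) ⋯ (1 - q ^ N)`. -/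
noncomputable def eulerProd (N : ℕ) : R⟦X⟧ := ∏ i ∈ range N, (1 - X ^ (i + 1))

/-- The inverse of `eulerProd R N`. -/
noncomputable def eulerProdInv (N : ℕ) : R⟦X⟧ := invOfUnit (eulerProd R N) 1

theorem eulerProd_mul_inv (N : ℕ) : eulerProd R N * eulerProdInv R N = 1 :=
  mul_invOfUnit _ _ (by simp [eulerProd, map_prod])

theorem eulerProd_succ (N : ℕ) : eulerProd R (N + 1) = eulerProd R N * (1 - X ^ (N + 1)) :=
  prod_range_succ _ _

theorem eulerProdInv_eq (N : ℕ) :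
    eulerProdInv R N = (1 - X ^ (N + 1)) * eulerProdInv R (N + 1) := by
  have h1 := eulerProd_mul_inv R N
  have h2 := eulerProd_mul_inv R (N + 1)
  rw [eulerProd_succ] at h2
  linear_combination (-eulerProdInv R N) * h2 +
    (1 - X ^ (N + 1)) * eulerProdInv R (N + 1) * h1

/-- The coefficients `(-1) ^ n q ^ (n (n + 1) / 2) [2 N + 1, N - n]_q` of the finite form of the
Jacobi triple product identity. -/
noncomputable def tripleCoeff (N n : ℕ) : R⟦X⟧ :=
  if n ≤ N then (-1) ^ n * X ^ tri n * eulerProd R (2 * N + 1) *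
    (eulerProdInv R (N - n) * eulerProdInv R (N + n + 1)) else 0

/-- Boundary case of the q-Pascal recurrence `tripleCoeff_succ`: the absent coefficient of index
`-1` is minus that of index `0`, by the antisymmetry `n ↔ -1 - n`. -/
theorem tripleCoeff_zero (N : ℕ) : tripleCoeff R (N + 1) 0 =
    (1 + (X ^ (N + 1)) ^ 2) * tripleCoeff R N 0 -
      X ^ (N + 1) * (-tripleCoeff R N 0 + tripleCoeff R N 1) := by
  have e1 : eulerProd R (2 * (N + 1) + 1) =
      eulerProd R (2 * N + 1) * (1 - X ^ (2 * N + 2)) * (1 - X ^ (2 * N + 3)) := by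
    rw [show 2 * (N + 1) + 1 = 2 * N + 1 + 1 + 1 by ring, eulerProd_succ, eulerProd_succ]
  have t1 : tri (1 : ℕ) = 1 := by decide
  have t0 : tri (0 : ℕ) = 0 := by decide
  have u1 := eulerProdInv_eq R N
  have u2 := eulerProdInv_eq R (N + 1)
  rcases N with _ | N
  · simp only [tripleCoeff, e1, t1, t0]
    norm_num
    norm_num at u1 u2
    rw [u1, u2]
    ring
  · have u0 := eulerProdInv_eq R N
    simp only [tripleCoeff, e1, t1, t0]
    simp only [zero_le, if_true, show 1 ≤ N + 1 by lia, Nat.sub_zero, Nat.add_zero,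
      Nat.add_sub_cancel]
    rw [u0, u1, u2]
    ring

theorem tripleCoeff_succ (N n : ℕ) : tripleCoeff R (N + 1) (n + 1) =
    (1 + (X ^ (N + 1)) ^ 2) * tripleCoeff R N (n + 1) -
      X ^ (N + 1) * (tripleCoeff R N n + tripleCoeff R N (n + 2)) := by
  have e1 : eulerProd R (2 * (N + 1) + 1) =
      eulerProd R (2 * N + 1) * (1 - X ^ (2 * N + 2)) * (1 - X ^ (2 * N + 3)) := by
    rw [show 2 * (N + 1) + 1 = 2 * N + 1 + 1 + 1 by ring, eulerProd_succ, eulerProd_succ]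
  have t1 : tri ((n + 1 : ℕ) : ℤ) = tri n + (n + 1) := tri_add_one n
  have t2 : tri ((n + 2 : ℕ) : ℤ) = tri n + (n + 1) + (n + 2) := by
    rw [← t1]; exact tri_add_one (n + 1)
  simp only [tripleCoeff, e1, t1, t2]
  rcases lt_trichotomy n N with h | rfl | h
  · obtain ⟨d, rfl⟩ := Nat.exists_eq_add_of_le (Nat.succ_le_of_lt h)
    have u1 := eulerProdInv_eq R d
    have v1 := eulerProdInv_eq R (2 * n + d + 2)
    have v2 := eulerProdInv_eq R (2 * n + d + 3)
    simp only [Nat.succ_eq_add_one]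
    rw [if_pos (by lia), if_pos (by lia), if_pos (by lia)]
    rw [show n + 1 + d + 1 - (n + 1) = d + 1 by lia, show n + 1 + d - (n + 1) = d by lia,
      show n + 1 + d - n = d + 1 by lia,
      show n + 1 + d + 1 + (n + 1) + 1 = 2 * n + d + 4 by ring,
      show n + 1 + d + (n + 1) + 1 = 2 * n + d + 3 by ring,
      show n + 1 + d + n + 1 = 2 * n + d + 2 by ring,
      show n + 1 + d + (n + 2) + 1 = 2 * n + d + 4 by ring]
    rw [v1, v2]
    rcases d with _ | d
    · rw [if_neg (by lia)]
      norm_num at u1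
      norm_num
      rw [u1]
      ring
    · have u0 := eulerProdInv_eq R d
      rw [if_pos (by lia), show n + 1 + (d + 1) - (n + 2) = d by lia, u0, u1]
      ring
  · rw [if_pos (by lia), if_neg (by lia), if_pos (by lia), if_neg (by lia)]
    have v1 := eulerProdInv_eq R (2 * n + 1)
    have v2 := eulerProdInv_eq R (2 * n + 2)
    rw [show n + 1 + (n + 1) + 1 = 2 * n + 3 by ring, show n + n + 1 = 2 * n + 1 by ring]
    simp only [Nat.sub_self]
    rw [v1, v2]
    ring
  · rw [if_neg (by lia), if_neg (by lia), if_neg (by lia), if_neg (by lia)]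
    ring

variable {R}

/-- The polynomials in `w` with `tripleWeight (2 - z - z⁻¹) n = z ^ (-n) + ⋯ + z ^ n`. -/
def tripleWeight (w : R) : ℕ → R
  | 0 => 1
  | 1 => 3 - w
  | n + 2 => (2 - w) * tripleWeight w (n + 1) - tripleWeight w n

/-- Multiplication by `z + z⁻¹ = 2 - w` sends the weight of index `n` to the sum of its two
neighbours, the weight of index `-1` being `-1`; the sum is then reindexed, leaving boundary terms
at `k`. -/
theorem sum_mul_tripleWeight (w : R) (D : ℕ → R⟦X⟧) (k : ℕ) :
    ∑ n ∈ range (k + 1), D n * (C (2 - w) * C (tripleWeight w n)) =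
      (-D 0 + D 1) * C (tripleWeight w 0) +
      ∑ n ∈ range k, (D n + D (n + 2)) * C (tripleWeight w (n + 1)) +
      D k * C (tripleWeight w (k + 1)) - D (k + 1) * C (tripleWeight w k) := by
  induction k with
  | zero =>
    simp only [zero_add, range_one, sum_singleton, range_zero, sum_empty, tripleWeight, map_sub,
      map_one, map_ofNat]
    ring
  | succ k ih =>
    rw [sum_range_succ, ih, sum_range_succ _ k,
      show tripleWeight w (k + 1 + 1) = (2 - w) * tripleWeight w (k + 1) - tripleWeight w k from rfl]
    simp only [map_sub, map_mul]
    ring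

/-- The finite form of the Jacobi triple product identity, in the variable
`w = 2 - z - z⁻¹`. -/
theorem prod_one_sub_sq_add (w : R) (N : ℕ) :
    ∏ i ∈ range N, ((1 - X ^ (i + 1)) ^ 2 + C w * X ^ (i + 1) : R⟦X⟧) =
      ∑ n ∈ range (N + 1), tripleCoeff R N n * C (tripleWeight w n) := by
  induction N with
  | zero =>
    have t0 : tri 0 = 0 := by decide
    have h1 := eulerProd_mul_inv R 1
    have h0 := eulerProd_mul_inv R 0
    rw [show eulerProd R 0 = 1 by simp [eulerProd], one_mul] at h0
    simp [tripleCoeff, tripleWeight, t0, h0, h1]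
  | succ N ih =>
    have hz : ∀ n, N < n → tripleCoeff R N n = 0 := fun n hn ↦ if_neg (by lia)
    have hs : ∑ n ∈ range (N + 1), tripleCoeff R N n * C (tripleWeight w n) =
        ∑ n ∈ range (N + 1 + 1), tripleCoeff R N n * C (tripleWeight w n) := by
      rw [sum_range_succ _ (N + 1), hz (N + 1) (by lia), zero_mul, add_zero]
    have key := sum_mul_tripleWeight w (tripleCoeff R N) (N + 1)
    rw [hz (N + 1) (by lia), hz (N + 1 + 1) (by lia), zero_mul, zero_mul, add_zero, sub_zero]
      at key
    have hfac : ((1 - X ^ (N + 1)) ^ 2 + C w * X ^ (N + 1) : R⟦X⟧) =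
        (1 + (X ^ (N + 1)) ^ 2) - X ^ (N + 1) * C (2 - w) := by
      simp only [map_sub, map_ofNat]; ring
    have h2 : (∑ n ∈ range (N + 1 + 1), tripleCoeff R N n * C (tripleWeight w n)) * C (2 - w) =
        ∑ n ∈ range (N + 1 + 1), tripleCoeff R N n * (C (2 - w) * C (tripleWeight w n)) := by
      rw [sum_mul]; exact sum_congr rfl fun _ _ ↦ by ring
    rw [prod_range_succ, ih, hs, hfac, mul_sub, mul_left_comm, h2, key, sum_range_succ',
      sum_range_succ' _ (N + 1), tripleCoeff_zero]
    have : ∀ n, ((1 + (X ^ (N + 1)) ^ 2) * tripleCoeff R N (n + 1) -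
        X ^ (N + 1) * (tripleCoeff R N n + tripleCoeff R N (n + 2))) * C (tripleWeight w (n + 1)) =
        tripleCoeff R N (n + 1) * C (tripleWeight w (n + 1)) * (1 + (X ^ (N + 1)) ^ 2) -
        X ^ (N + 1) * ((tripleCoeff R N n + tripleCoeff R N (n + 2)) *
          C (tripleWeight w (n + 1))) := fun n ↦ by ring
    simp only [tripleCoeff_succ, this, sum_sub_distrib, ← sum_mul, ← mul_sum]
    ring

end Finite

/-! ### Passage to the limit and the generating function -/

theorem coeff_eulerProd {R : Type*} [CommRing R] {d N : ℕ} (h : d ≤ N) :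
    (eulerProd R N).coeff d = (pentagonalSeries R).coeff d := by
  have hstep : ∀ M, d ≤ M → (eulerProd R M).coeff d = (eulerProd R N).coeff d := by
    have : ∀ M, d ≤ M → (eulerProd R M).coeff d = (eulerProd R d).coeff d := fun M hM ↦ by
      induction M, hM using Nat.le_induction with
      | base => rfl
      | succ M hM ih =>
        rw [eulerProd_succ, mul_sub, mul_one, map_sub, ih, coeff_mul_X_pow', if_neg (by lia),
          sub_zero]
    exact fun M hM ↦ (this M hM).trans (this N h).symm
  obtain ⟨s, hs⟩ := eventually_atTop.1 (coeff_prod_one_sub_X_pow_eventually_eq R d)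
  obtain ⟨M, hM⟩ := s.exists_nat_subset_range
  rw [← hstep (max M d) (le_max_right _ _)]
  exact hs _ (hM.trans (range_subset_range.2 (le_max_left _ _)))

/-- The local factor of one part size: `∑ j Y^j = Y / (1 - Y)^2`, obtained by multiplying twice by
`1 - Y`. -/
theorem tsum_mul_X_pow (R : Type*) [CommRing R] [TopologicalSpace R] [DiscreteTopology R]
    (w : R) (i : ℕ) :
    (1 - X ^ (i + 1)) ^ 2 * (1 + ∑' j : ℕ, (w * (j + 1 : ℕ)) • (X : R⟦X⟧) ^ ((i + 1) * (j + 1))) =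
      (1 - X ^ (i + 1)) ^ 2 + C w * X ^ (i + 1) := by
  set Y : R⟦X⟧ := X ^ (i + 1)
  have hs : Summable fun j : ℕ ↦ (w * (j + 1 : ℕ)) • (X : R⟦X⟧) ^ ((i + 1) * (j + 1)) := by
    have := Nat.Partition.summable_genFun_term' (R := R) (fun _ s ↦ w * s) (Nat.succ_ne_zero i)
    simpa using this
  have hc : ∀ c j : ℕ, (w * c) • (X : R⟦X⟧) ^ ((i + 1) * j) = C w * (c : R⟦X⟧) * Y ^ j := by
    intro c j
    rw [smul_eq_C_mul, pow_mul, map_mul, map_natCast]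
  simp only [hc] at hs ⊢
  have h1 := hs.hasSum
  set S := ∑' j : ℕ, C w * ((j + 1 : ℕ) : R⟦X⟧) * Y ^ (j + 1)
  -- `(1 - Y) * S = ∑ C w * Y ^ (j + 1)`
  have h2 : HasSum (fun j : ℕ ↦ C w * (j : R⟦X⟧) * Y ^ j) S := by
    have := (hasSum_nat_add_iff (f := fun j : ℕ ↦ C w * (j : R⟦X⟧) * Y ^ j) 1).1 h1
    simpa using this
  have h3 : HasSum (fun j : ℕ ↦ C w * Y ^ (j + 1)) (S * (1 - Y)) := by
    rw [show (fun j : ℕ ↦ C w * Y ^ (j + 1)) = fun j : ℕ ↦ C w * ((j + 1 : ℕ) : R⟦X⟧) * Y ^ (j + 1) -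
      Y * (C w * (j : R⟦X⟧) * Y ^ j) by ext1 j; push_cast; ring, mul_sub, mul_one, mul_comm S Y]
    exact h1.sub (h2.mul_left Y)
  have h4 : HasSum (fun j : ℕ ↦ C w * Y ^ (j + 2)) (S * (1 - Y) - C w * Y) := by
    have := (hasSum_nat_add_iff' (f := fun j : ℕ ↦ C w * Y ^ (j + 1)) 1).2 h3
    simpa [add_assoc] using this
  have h5 := h3.mul_left Y
  rw [show (fun j : ℕ ↦ Y * (C w * Y ^ (j + 1))) = fun j : ℕ ↦ C w * Y ^ (j + 2) by
    ext1 j; ring] at h5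
  have h6 := h5.unique h4
  linear_combination -h6

/-- The generating function identity of MacMahon, with `w` marking the number of part sizes. -/
theorem coeff_genFun_mul_pentagonalSeries {R : Type*} [CommRing R] (w : R) (m : ℕ) :
    (pentagonalSeries R ^ 3 * Nat.Partition.genFun fun _ s ↦ w * s).coeff m =
      ∑ n ∈ range (m + 1), if tri n = m then (-1) ^ n * tripleWeight w n else 0 := by
  let _ : TopologicalSpace R := ⊥
  have : DiscreteTopology R := ⟨rfl⟩
  set E := pentagonalSeries R
  set G := Nat.Partition.genFun fun _ s : ℕ ↦ w * (s : R)
  have tE : Tendsto (eulerProd R) atTop (𝓝 E) :=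
    (WithPiTopology.tendsto_iff_coeff_tendsto _ _ _ _).2 fun d ↦
      tendsto_atTop_of_eventually_const (i₀ := d) fun N hN ↦ coeff_eulerProd hN
  have tInv : Tendsto (fun N ↦ E * eulerProdInv R N) atTop (𝓝 1) := by
    refine (WithPiTopology.tendsto_iff_coeff_tendsto _ _ _ _).2 fun d ↦
      tendsto_atTop_of_eventually_const (i₀ := d) fun N hN ↦ ?_
    rw [← eulerProd_mul_inv R N, coeff_mul, coeff_mul]
    refine sum_congr rfl fun x hx ↦ ?_
    rw [coeff_eulerProd (by have := mem_antidiagonal.1 hx; lia)]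
  have tG : Tendsto (fun N ↦ ∏ i ∈ range N, ((1 - X ^ (i + 1)) ^ 2 + C w * X ^ (i + 1) : R⟦X⟧))
      atTop (𝓝 (E ^ 2 * G)) := by
    have := (tE.pow 2).mul (Nat.Partition.hasProd_genFun (R := R)
      fun _ s ↦ w * s).tendsto_prod_nat
    refine this.congr fun N ↦ ?_
    rw [eulerProd, ← prod_pow, ← prod_mul_distrib]
    exact prod_congr rfl fun i _ ↦ tsum_mul_X_pow R w i
  have tL : Tendsto (fun N ↦ (E * ∏ i ∈ range N,
      ((1 - X ^ (i + 1)) ^ 2 + C w * X ^ (i + 1) : R⟦X⟧)).coeff m) atTop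
      (𝓝 ((E ^ 3 * G).coeff m)) := by
    rw [show E ^ 3 * G = E * (E ^ 2 * G) by ring]
    exact (WithPiTopology.tendsto_iff_coeff_tendsto _ _ _ _).1 (tG.const_mul E) m
  have tD : ∀ n, Tendsto (fun N ↦ E * (tripleCoeff R N n * C (tripleWeight w n))) atTop
      (𝓝 ((-1) ^ n * X ^ tri n * C (tripleWeight w n))) := by
    intro n
    have a1 : Tendsto (fun N ↦ 2 * N + 1) atTop atTop :=
      tendsto_atTop_mono (fun N ↦ by simp only [id]; lia) tendsto_id
    have a2 : Tendsto (fun N ↦ N - n) atTop atTop := tendsto_sub_atTop_nat n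
    have a3 : Tendsto (fun N ↦ N + n + 1) atTop atTop :=
      tendsto_atTop_mono (fun N ↦ by simp only [id]; lia) tendsto_id
    have u : IsUnit E := by
      rw [isUnit_iff_constantCoeff, ← coeff_zero_eq_constantCoeff_apply,
        ← coeff_eulerProd (le_refl 0)]
      simp [eulerProd]
    -- The known limit is that of `E * eulerProdInv`, and two such factors are needed but only one
    -- `E` is at hand; `U = E⁻¹` compensates for the second.
    obtain ⟨U, hU⟩ := u.exists_right_inv
    have b := (((tE.comp a1).mul (tInv.comp a2)).mul (tInv.comp a3)).mul_const
      (U * (-1) ^ n * X ^ tri n * C (tripleWeight w n))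
    have hlim : E * 1 * 1 * (U * (-1) ^ n * X ^ tri n * C (tripleWeight w n)) =
        (-1) ^ n * X ^ tri n * C (tripleWeight w n) := by
      linear_combination ((-1) ^ n * X ^ tri n * C (tripleWeight w n)) * hU
    rw [hlim] at b
    refine b.congr' ?_
    filter_upwards [eventually_ge_atTop n] with N hN
    simp only [tripleCoeff, if_pos hN, Function.comp_apply]
    linear_combination (E * (-1) ^ n * X ^ tri n * eulerProd R (2 * N + 1) *
      (eulerProdInv R (N - n) * eulerProdInv R (N + n + 1)) * C (tripleWeight w n)) * hU
  have tR : Tendsto (fun N ↦ ∑ n ∈ range (m + 1),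
      (E * (tripleCoeff R N n * C (tripleWeight w n))).coeff m) atTop
      (𝓝 (∑ n ∈ range (m + 1), ((-1) ^ n * X ^ tri n * C (tripleWeight w n) : R⟦X⟧).coeff m)) :=
    tendsto_finsetSum _ fun n _ ↦
      (WithPiTopology.tendsto_iff_coeff_tendsto _ _ _ _).1 (tD n) m
  have heq : (E ^ 3 * G).coeff m =
      ∑ n ∈ range (m + 1), ((-1) ^ n * X ^ tri n * C (tripleWeight w n) : R⟦X⟧).coeff m := by
    refine tendsto_nhds_unique tL (tR.congr' ?_)
    filter_upwards [eventually_ge_atTop m] with N hN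
    rw [prod_one_sub_sq_add, mul_sum, map_sum]
    refine sum_subset (range_subset_range.2 (by lia)) fun n _ hn ↦ ?_
    have hmn : m < tri n := lt_of_lt_of_le (by simpa using hn) (le_tri n)
    rw [tripleCoeff]
    split_ifs with h
    · rw [show E * ((-1) ^ n * X ^ tri n * eulerProd R (2 * N + 1) *
        (eulerProdInv R (N - n) * eulerProdInv R (N + n + 1)) * C (tripleWeight w n)) =
        E * (-1) ^ n * eulerProd R (2 * N + 1) *
        (eulerProdInv R (N - n) * eulerProdInv R (N + n + 1)) * C (tripleWeight w n) * X ^ tri n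
        by ring, coeff_mul_X_pow', if_neg (by lia)]
    · simp
  rw [heq]
  refine sum_congr rfl fun n _ ↦ ?_
  rw [show ((-1) ^ n * X ^ tri n * C (tripleWeight w n) : R⟦X⟧) =
    C ((-1) ^ n * tripleWeight w n) * X ^ tri n by simp; ring, coeff_C_mul_X_pow]
  simp only [eq_comm]

theorem tripleWeight_zero {R : Type*} [CommRing R] : ∀ n : ℕ, tripleWeight (0 : R) n = 2 * n + 1
  | 0 => by simp [tripleWeight]
  | 1 => by simp [tripleWeight]; norm_num
  | n + 2 => by
    rw [tripleWeight, tripleWeight_zero (n + 1), tripleWeight_zero n]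
    push_cast
    ring

/-- Jacobi's identity for the cube of the Euler product. -/
theorem coeff_pentagonalSeries_pow_three (R : Type*) [CommRing R] (m : ℕ) :
    (pentagonalSeries R ^ 3).coeff m =
      ∑ n ∈ range (m + 1), if tri n = m then (-1) ^ n * (2 * n + 1 : R) else 0 := by
  -- At `w = 0`, that is `z = 1`, only the empty partition contributes.
  have h := coeff_genFun_mul_pentagonalSeries (0 : R) m
  have hG : (Nat.Partition.genFun fun _ s : ℕ ↦ (0 : R) * s) = 1 := by
    let _ : TopologicalSpace R := ⊥
    have : DiscreteTopology R := ⟨rfl⟩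
    rw [Nat.Partition.genFun_eq_tprod]
    simp
  rw [hG, mul_one] at h
  simpa only [tripleWeight_zero] using h

/-! ### Theta series over ℤ and ℤ³ -/

section Theta
variable {R : Type*} [CommRing R] [TopologicalSpace R]

theorem summable_intCast_mul_X_pow {ι : Type*} (c : ι → ℤ) {e : ι → ℕ}
    (he : ∀ d, {x | e x ≤ d}.Finite) : Summable fun x ↦ (c x : R⟦X⟧) * X ^ e x := by
  refine (WithPiTopology.summable_iff_summable_coeff _).2 fun d ↦
    summable_of_hasFiniteSupport ((he d).subset fun x hx ↦ ?_)
  by_contra h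
  refine hx ?_
  dsimp only
  rw [coeff_mul_X_pow']
  exact if_neg h

theorem finite_tri_le (d : ℕ) : {k : ℤ | tri k ≤ d}.Finite := by
  refine (Set.finite_Icc (-(d + 1) : ℤ) (d + 1)).subset fun k hk ↦ ?_
  have := natAbs_le_tri_add_one k
  simp only [Set.mem_ofPred_eq] at hk
  constructor <;> lia

/-- The general term of the theta series with polynomial weight `k ^ r`. -/
noncomputable def thetaTerm (R : Type*) [CommRing R] (r : ℕ) (k : ℤ) : R⟦X⟧ :=
  ((k.negOnePow * k ^ r : ℤ) : R⟦X⟧) * X ^ tri k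

theorem summable_thetaTerm (r : ℕ) : Summable (thetaTerm R r) :=
  summable_intCast_mul_X_pow _ finite_tri_le

variable [DiscreteTopology R]

/-- The terms at `k` and `-(k + 1)` have equal exponents and opposite signs. -/
theorem hasSum_thetaTerm_zero : HasSum (thetaTerm R 0) 0 := by
  have h := (summable_thetaTerm (R := R) 0).hasSum
  have h' := h.nat_add_neg_add_one
  have : (fun n : ℕ ↦ thetaTerm R 0 n + thetaTerm R 0 (-(n + 1))) = fun _ ↦ 0 := by
    ext1 n
    simp only [thetaTerm, tri_neg_add_one, Int.negOnePow_neg, Int.negOnePow_succ]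
    push_cast
    ring
  rw [this] at h'
  rwa [h'.unique hasSum_zero] at h

theorem hasSum_thetaTerm_one : HasSum (thetaTerm R 1) (pentagonalSeries R ^ 3) := by
  have h := (summable_thetaTerm (R := R) 1).hasSum
  have h' := h.nat_add_neg_add_one
  have : (fun n : ℕ ↦ thetaTerm R 1 n + thetaTerm R 1 (-(n + 1))) =
      fun n : ℕ ↦ (-1) ^ n * (2 * (n : R⟦X⟧) + 1) * X ^ tri n := by
    ext1 n
    simp only [thetaTerm, tri_neg_add_one, Int.negOnePow_neg, Int.negOnePow_succ]
    simp only [Int.negOnePow_def, zpow_natCast]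
    push_cast
    ring
  rw [this] at h'
  have h2 : HasSum (fun n : ℕ ↦ (-1) ^ n * (2 * (n : R⟦X⟧) + 1) * X ^ tri n) (pentagonalSeries R ^ 3) := by
    refine (WithPiTopology.hasSum_iff_hasSum_coeff _).2 fun m ↦ ?_
    have hc : ∀ n : ℕ, coeff m ((-1) ^ n * (2 * (n : R⟦X⟧) + 1) * X ^ tri n : R⟦X⟧) =
        if tri n = m then (-1) ^ n * (2 * (n : R) + 1) else 0 := fun n ↦ by
      rw [show ((-1) ^ n * (2 * (n : R⟦X⟧) + 1) * X ^ tri n : R⟦X⟧) =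
        C ((-1) ^ n * (2 * (n : R) + 1)) * X ^ tri n by simp [map_ofNat], coeff_C_mul_X_pow]
      simp only [eq_comm]
    simp only [hc]
    rw [coeff_pentagonalSeries_pow_three]
    refine hasSum_sum_of_ne_finset_zero fun n hn ↦ if_neg ?_
    have := le_tri n
    simp only [mem_range] at hn
    lia
  rwa [h'.unique h2] at h

theorem hasSum_thetaTerm_mul (r s t : ℕ) : HasSum (fun x : ℤ × ℤ × ℤ ↦
    ((x.1.negOnePow * x.2.1.negOnePow * x.2.2.negOnePow *
      (x.1 ^ r * x.2.1 ^ s * x.2.2 ^ t) : ℤ) : R⟦X⟧) * X ^ (tri x.1 + tri x.2.1 + tri x.2.2))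
    ((∑' k, thetaTerm R r k) * ((∑' k, thetaTerm R s k) * ∑' k, thetaTerm R t k)) := by
  have s2 : Summable fun x : ℤ × ℤ ↦ thetaTerm R s x.1 * thetaTerm R t x.2 := by
    have f2 : ∀ d, {x : ℤ × ℤ | tri x.1 + tri x.2 ≤ d}.Finite := fun d ↦
      ((finite_tri_le d).prod (finite_tri_le d)).subset fun x hx ↦ by
        simp only [Set.mem_ofPred_eq] at hx
        constructor <;> simp only [Set.mem_ofPred_eq] <;> lia
    refine (summable_intCast_mul_X_pow (R := R)
      (fun x : ℤ × ℤ ↦ x.1.negOnePow * x.2.negOnePow * (x.1 ^ s * x.2 ^ t)) f2).congr fun x ↦ ?_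
    simp only [thetaTerm]
    push_cast
    ring
  have f3 : ∀ d, {x : ℤ × ℤ × ℤ | tri x.1 + tri x.2.1 + tri x.2.2 ≤ d}.Finite := fun d ↦
    ((finite_tri_le d).prod ((finite_tri_le d).prod (finite_tri_le d))).subset fun x hx ↦ by
      simp only [Set.mem_ofPred_eq] at hx
      refine ⟨?_, ?_, ?_⟩ <;> simp only [Set.mem_ofPred_eq] <;> lia
  have s3 := summable_intCast_mul_X_pow (R := R) (fun x : ℤ × ℤ × ℤ ↦
    x.1.negOnePow * x.2.1.negOnePow * x.2.2.negOnePow * (x.1 ^ r * x.2.1 ^ s * x.2.2 ^ t)) f3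
  have e3 : ∀ x : ℤ × ℤ × ℤ, ((x.1.negOnePow * x.2.1.negOnePow * x.2.2.negOnePow *
      (x.1 ^ r * x.2.1 ^ s * x.2.2 ^ t) : ℤ) : R⟦X⟧) * X ^ (tri x.1 + tri x.2.1 + tri x.2.2) =
      thetaTerm R r x.1 * (thetaTerm R s x.2.1 * thetaTerm R t x.2.2) := by
    intro x
    simp only [thetaTerm]
    push_cast
    ring
  have h1 := (summable_thetaTerm (R := R) r).hasSum
  have h2 := (summable_thetaTerm (R := R) s).hasSum.mul (summable_thetaTerm (R := R) t).hasSum s2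
  have h3 := h1.mul h2 (s3.congr e3)
  exact h3.congr_fun e3

/-- The ninth power of the Euler product as a sum over `ℤ³` with a translation invariant weight. -/
theorem hasSum_pentagonalSeries_pow_nine : HasSum (fun x : ℤ × ℤ × ℤ ↦
    ((x.1.negOnePow * x.2.1.negOnePow * x.2.2.negOnePow *
      ((x.1 - x.2.2) ^ 2 * (x.2.1 - x.2.2)) : ℤ) : R⟦X⟧) * X ^ (tri x.1 + tri x.2.1 + tri x.2.2))
    (-2 * pentagonalSeries R ^ 9) := by
  -- In the expansion of `(x - z)^2 (y - z)` every monomial except `-2xyz` omits a variable, so its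
  -- sum has the vanishing weight-0 theta series as a factor.
  have z := (hasSum_thetaTerm_zero (R := R)).tsum_eq
  have o := (hasSum_thetaTerm_one (R := R)).tsum_eq
  have h1 := hasSum_thetaTerm_mul (R := R) 2 1 0
  have h2 := hasSum_thetaTerm_mul (R := R) 2 0 1
  have h3 := (hasSum_thetaTerm_mul (R := R) 1 1 1).mul_left 2
  have h4 := (hasSum_thetaTerm_mul (R := R) 1 0 2).mul_left 2
  have h5 := hasSum_thetaTerm_mul (R := R) 0 1 2
  have h6 := hasSum_thetaTerm_mul (R := R) 0 0 3
  rw [z, o, mul_zero, mul_zero] at h1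
  rw [z, zero_mul, mul_zero] at h2 h4
  rw [o] at h3
  rw [z, zero_mul] at h5 h6
  have h := (((h1.sub h2).sub h3).add h4).add (h5.sub h6)
  refine (congrArg₂ (fun f a ↦ HasSum f a) ?_ ?_).mp h
  · ext1 x
    push_cast
    ring
  · ring

/-- Summing over the translations, by the pentagonal number theorem. -/
theorem hasSum_translates (a b t : ℤ) (h : a + b = 3 * t - 1 ∨ a + b = 3 * t - 2) :
    ∃ ε : ℤ, HasSum (fun k : ℤ ↦ (((a + k).negOnePow * (b + k).negOnePow * k.negOnePow *
      (a ^ 2 * b) : ℤ) : R⟦X⟧) * X ^ (tri (a + k) + tri (b + k) + tri k))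
      (pentagonalSeries R * (((ε * (a ^ 2 * b) : ℤ) : R⟦X⟧) *
        X ^ (tri (a - t) + tri (b - t) + tri (-t)))) := by
  have hP := WithPiTopology.hasSum_pentagonalSeries R
  have sgn : ∀ k : ℤ, (((a + k).negOnePow : ℤ) * (b + k).negOnePow * k.negOnePow) =
      ((a + b + k).negOnePow : ℤ) := fun k ↦ by
    have h1 : ((k.negOnePow : ℤ)) * k.negOnePow = 1 := by
      rw [← Units.val_mul, ← Int.negOnePow_add, Int.negOnePow_even _ (⟨k, rfl⟩)]
      rfl
    simp only [Int.negOnePow_add, Units.val_mul]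
    linear_combination (a.negOnePow : ℤ) * b.negOnePow * k.negOnePow * h1
  simp only [sgn]
  rcases h with h | h
  · refine ⟨-1, ?_⟩
    -- Centring at `-t` leaves linear term `+k/2` beside `3k^2/2`; the reflection makes it
    -- pentagonal. In the other case it is already `-k/2`, so a shift suffices.
    rw [← (Equiv.subLeft (-t)).hasSum_iff]
    have := hP.mul_right (((-1 * (a ^ 2 * b) : ℤ) : R⟦X⟧) *
        X ^ (tri (a - t) + tri (b - t) + tri (-t)))
    refine (congrArg₂ (fun f a ↦ HasSum f a) ?_ rfl).mp this
    ext1 k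
    simp only [Function.comp_apply, Equiv.subLeft_apply]
    have e : tri (a + (-t - k)) + tri (b + (-t - k)) + tri (-t - k) =
        pentagonal k + (tri (a - t) + tri (b - t) + tri (-t)) := by
      have h0 := two_mul_natCast_pentagonal k
      have h1 := two_mul_tri (a - t)
      have h2 := two_mul_tri (b - t)
      have h3 := two_mul_tri (-t)
      have h4 := two_mul_tri (a + (-t - k))
      have h5 := two_mul_tri (b + (-t - k))
      have h6 := two_mul_tri (-t - k)
      obtain rfl : b = 3 * t - 1 - a := by lia
      zify
      linarith
    have s : ((a + b + (-t - k)).negOnePow : ℤ) = -k.negOnePow := by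
      rw [show a + b + (-t - k) = -(k + 1) + (t + t) by lia, Int.negOnePow_add,
        Int.negOnePow_even _ (⟨t, rfl⟩), mul_one, Int.negOnePow_neg, Int.negOnePow_succ]
      rfl
    rw [e, s, pow_add]
    push_cast
    ring
  · refine ⟨1, ?_⟩
    rw [← (Equiv.subRight t).hasSum_iff]
    have := hP.mul_right (((1 * (a ^ 2 * b) : ℤ) : R⟦X⟧) *
        X ^ (tri (a - t) + tri (b - t) + tri (-t)))
    refine (congrArg₂ (fun f a ↦ HasSum f a) ?_ rfl).mp this
    ext1 k
    simp only [Function.comp_apply, Equiv.subRight_apply]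
    have e : tri (a + (k - t)) + tri (b + (k - t)) + tri (k - t) =
        pentagonal k + (tri (a - t) + tri (b - t) + tri (-t)) := by
      have h0 := two_mul_natCast_pentagonal k
      have h1 := two_mul_tri (a - t)
      have h2 := two_mul_tri (b - t)
      have h3 := two_mul_tri (-t)
      have h4 := two_mul_tri (a + (k - t))
      have h5 := two_mul_tri (b + (k - t))
      have h6 := two_mul_tri (k - t)
      obtain rfl : b = 3 * t - 2 - a := by lia
      zify
      linarith
    have s : ((a + b + (k - t)).negOnePow : ℤ) = k.negOnePow := by
      rw [show a + b + (k - t) = k + ((t - 1) + (t - 1)) by lia, Int.negOnePow_add,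
        Int.negOnePow_even _ (⟨_, rfl⟩), mul_one]
    rw [e, s, pow_add]
    push_cast
    ring

/-- The reflection `k ↦ -2t - 1 - k` preserves the exponent and flips all three signs, so the sum
equals its own negative. -/
theorem hasSum_translates_zero (h2 : IsUnit (2 : R)) (a b t : ℤ) (h : a + b = 3 * t) :
    HasSum (fun k : ℤ ↦ (((a + k).negOnePow * (b + k).negOnePow * k.negOnePow *
      (a ^ 2 * b) : ℤ) : R⟦X⟧) * X ^ (tri (a + k) + tri (b + k) + tri k)) 0 := by
  set f := fun k : ℤ ↦ (((a + k).negOnePow * (b + k).negOnePow * k.negOnePow *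
      (a ^ 2 * b) : ℤ) : R⟦X⟧) * X ^ (tri (a + k) + tri (b + k) + tri k)
  have hs : Summable f := summable_intCast_mul_X_pow _ fun d ↦ (finite_tri_le d).subset fun k hk ↦ by
    simp only [Set.mem_ofPred_eq] at hk ⊢
    lia
  have hf := hs.hasSum
  have hg := (Equiv.subLeft (-2 * t - 1)).hasSum_iff.2 hf
  have hfg : f ∘ Equiv.subLeft (-2 * t - 1) = fun k ↦ -f k := by
    ext1 k
    simp only [Function.comp_apply, Equiv.subLeft_apply, f]
    have e : tri (a + (-2 * t - 1 - k)) + tri (b + (-2 * t - 1 - k)) + tri (-2 * t - 1 - k) =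
        tri (a + k) + tri (b + k) + tri k := by
      have h1 := two_mul_tri (a + (-2 * t - 1 - k))
      have h2 := two_mul_tri (b + (-2 * t - 1 - k))
      have h3 := two_mul_tri (-2 * t - 1 - k)
      have h4 := two_mul_tri (a + k)
      have h5 := two_mul_tri (b + k)
      have h6 := two_mul_tri k
      obtain rfl : b = 3 * t - a := by lia
      zify
      linarith
    have s : ∀ c : ℤ, ((c + (-2 * t - 1 - k)).negOnePow : ℤ) = -(c + k).negOnePow := fun c ↦ by
      rw [show c + (-2 * t - 1 - k) = c + k + 1 + (-(t + k + 1) + -(t + k + 1)) by ring,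
        Int.negOnePow_add, Int.negOnePow_even _ (⟨_, rfl⟩), mul_one, Int.negOnePow_succ]
      rfl
    have s0 := s 0
    rw [zero_add, zero_add] at s0
    rw [e, s, s, s0]
    push_cast
    ring
  rw [hfg] at hg
  have h0 := hg.unique hf.neg
  have hu : IsUnit (2 : R⟦X⟧) := by
    have := h2.map (C (R := R))
    rwa [map_ofNat] at this
  have h1 : (2 : R⟦X⟧) * ∑' k, f k = 0 := by linear_combination h0
  rwa [hu.mul_right_eq_zero.1 h1] at hf

end Theta

/-! ### The eighth power modulo 11 -/

theorem isUnit_pentagonalSeries (R : Type*) [CommRing R] : IsUnit (pentagonalSeries R) := by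
  rw [isUnit_iff_constantCoeff, ← coeff_zero_eq_constantCoeff_apply,
    ← coeff_eulerProd (le_refl 0)]
  simp [eulerProd]

/-- The norm form `a ^ 2 - a * b + b ^ 2` is anisotropic modulo `11`. -/
theorem zmod_eleven_eq_zero : ∀ a t : ZMod 11, ∀ s : ZMod 11, s = 1 ∨ s = 2 →
    (a - t) * (a - t + 1) + (3 * t - s - a - t) * (3 * t - s - a - t + 1) + -t * (-t + 1) = 14 →
    a = 0 := by
  decide

/-- The exponent `N` satisfies `3N + 1 = a^2 - ab + b^2`, and `3 * 7 + 1 = 22`. As `-3` is not a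
square modulo 11, `a` vanishes there, and with it the coefficient. -/
theorem coeff_translate_eq_zero (ε a b t : ℤ) (h : a + b = 3 * t - 1 ∨ a + b = 3 * t - 2) (n : ℕ) :
    (((ε * (a ^ 2 * b) : ℤ) : (ZMod 11)⟦X⟧) *
      X ^ (tri (a - t) + tri (b - t) + tri (-t))).coeff (11 * n + 7) = 0 := by
  rw [← map_intCast (C (R := ZMod 11)), coeff_C_mul_X_pow]
  split_ifs with hn
  · have h1 := two_mul_tri (a - t)
    have h2 := two_mul_tri (b - t)
    have h3 := two_mul_tri (-t)
    have key : (a - t) * (a - t + 1) + (b - t) * (b - t + 1) + -t * (-t + 1) = 22 * n + 14 := by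
      zify at hn
      linarith
    have key' := congrArg (Int.cast : ℤ → ZMod 11) key
    have h22 : (22 : ZMod 11) = 0 := by decide
    push_cast at key'
    rw [h22, zero_mul, zero_add] at key'
    have ha : (a : ZMod 11) = 0 := by
      rcases h with h | h
      · obtain rfl : b = 3 * t - 1 - a := by omega
        refine zmod_eleven_eq_zero a t 1 (Or.inl rfl) ?_
        push_cast at key'
        exact key'
      · obtain rfl : b = 3 * t - 2 - a := by omega
        refine zmod_eleven_eq_zero a t 2 (Or.inr rfl) ?_
        push_cast at key'
        exact key'
    push_cast
    rw [ha]
    ring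
  · rfl

/-- The translation of `ℤ³` along the diagonal, as a change of coordinates. -/
def translateEquiv : (ℤ × ℤ) × ℤ ≃ ℤ × ℤ × ℤ where
  toFun x := (x.1.1 + x.2, x.1.2 + x.2, x.2)
  invFun x := ((x.1 - x.2.2, x.2.1 - x.2.2), x.2.2)
  left_inv x := by simp
  right_inv x := by simp

/-- The eighth power of the Euler product has no terms of exponent `7` modulo `11`,
modulo `11`. -/
theorem coeff_pentagonalSeries_pow_eight (n : ℕ) :
    (pentagonalSeries (ZMod 11) ^ 8).coeff (11 * n + 7) = 0 := by
  let _ : TopologicalSpace (ZMod 11) := ⊥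
  have : DiscreteTopology (ZMod 11) := ⟨rfl⟩
  set E := pentagonalSeries (ZMod 11) with hE
  have h := translateEquiv.hasSum_iff.2 (hasSum_pentagonalSeries_pow_nine (R := ZMod 11))
  have hfib : ∀ x : ℤ × ℤ, ∃ r : (ZMod 11)⟦X⟧, r.coeff (11 * n + 7) = 0 ∧
      HasSum (fun k : ℤ ↦ (((x.1 + k).negOnePow * (x.2 + k).negOnePow * k.negOnePow *
      (x.1 ^ 2 * x.2) : ℤ) : (ZMod 11)⟦X⟧) * X ^ (tri (x.1 + k) + tri (x.2 + k) + tri k))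
      (E * r) := by
    rintro ⟨a, b⟩
    obtain ⟨t, ht⟩ : ∃ t : ℤ, a + b = 3 * t ∨ a + b = 3 * t - 1 ∨ a + b = 3 * t - 2 :=
      ⟨(a + b + 2) / 3, by lia⟩
    rcases ht with ht | ht
    · refine ⟨0, by simp, ?_⟩
      rw [mul_zero]
      exact hasSum_translates_zero (by decide) a b t ht
    · obtain ⟨ε, hε⟩ := hasSum_translates (R := ZMod 11) a b t ht
      exact ⟨_, coeff_translate_eq_zero ε a b t ht n, hε⟩
  choose r hr hsum using hfib
  have h' : HasSum (fun x : ℤ × ℤ ↦ E * r x) (-2 * E ^ 9) := by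
    refine h.prod_fiberwise fun x ↦ (hsum x).congr_fun fun k ↦ ?_
    simp only [Function.comp_apply, translateEquiv, Equiv.coe_fn_mk, add_sub_cancel_right]
  -- Each fibre sum carries a factor `E`; cancelling it turns the expansion of `-2 E^9` into one of
  -- `-2 E^8`.
  obtain ⟨U, hU⟩ := (isUnit_pentagonalSeries (ZMod 11)).exists_right_inv
  rw [← hE] at hU
  have h2 := h'.mul_left U
  have e1 : (fun x ↦ U * (E * r x)) = r := by
    ext1 x
    linear_combination r x * hU
  have e2 : U * (-2 * E ^ 9) = C (-2) * E ^ 8 := by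
    rw [map_neg, map_ofNat]
    linear_combination -2 * E ^ 8 * hU
  rw [e1, e2] at h2
  have h3 := (WithPiTopology.hasSum_iff_hasSum_coeff _).1 h2 (11 * n + 7)
  simp only [hr] at h3
  have h4 := h3.unique hasSum_zero
  rw [coeff_C_mul] at h4
  have hu : IsUnit (-2 : ZMod 11) := by decide
  exact hu.mul_right_eq_zero.1 h4

/-! ### Series in `q^11` and the conclusion -/

/-- The derivative of an 11th power vanishes in characteristic 11. -/
theorem coeff_pow_eleven (f : (ZMod 11)⟦X⟧) {n : ℕ} (hn : ¬ 11 ∣ n) : (f ^ 11).coeff n = 0 := by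
  obtain _ | n := n
  · simp at hn
  have h : derivative (ZMod 11) (f ^ 11) = 0 := by
    rw [Derivation.leibniz_pow]
    have : (11 : (ZMod 11)⟦X⟧) = 0 := by
      rw [← map_ofNat (C (R := ZMod 11))]
      have : (OfNat.ofNat 11 : ZMod 11) = 0 := by decide
      rw [this, map_zero]
    rw [nsmul_eq_mul]
    push_cast
    rw [this, zero_mul]
  have h1 := congrArg (coeff n) h
  rw [coeff_derivative, map_zero] at h1
  have : Fact (Nat.Prime 11) := ⟨by norm_num⟩
  refine (mul_eq_zero.1 h1).resolve_right fun h2 ↦ hn ?_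
  rw [← ZMod.natCast_eq_zero_iff]
  exact_mod_cast h2

/-- The recursion for the weights becomes, coefficientwise, the second-difference form of Pascal's
rule. -/
theorem coeff_tripleWeight {R : Type*} [CommRing R] : ∀ n a : ℕ,
    (tripleWeight (Polynomial.X : Polynomial R) n).coeff a =
      (-1) ^ a * (((n + a + 1).choose (2 * a + 1) + (n + a).choose (2 * a + 1) : ℕ) : R)
  | 0, a => by
    rcases a with _ | a
    · simp [tripleWeight]
    · rw [Nat.choose_eq_zero_of_lt (by lia), Nat.choose_eq_zero_of_lt (by lia)]
      simp [tripleWeight, Polynomial.coeff_one]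
  | 1, a => by
    have h3 : (3 : Polynomial R) = Polynomial.C 3 := (map_ofNat Polynomial.C 3).symm
    rcases a with _ | _ | a
    · simp [tripleWeight, h3]
    · simp [tripleWeight, h3]
    · rw [Nat.choose_eq_zero_of_lt (by lia), Nat.choose_eq_zero_of_lt (by lia)]
      simp [tripleWeight, h3, Polynomial.coeff_X]
  | n + 2, a => by
    have h2 : (2 : Polynomial R) = Polynomial.C 2 := (map_ofNat Polynomial.C 2).symm
    have h : ∀ m b : ℕ, (m + 2).choose (b + 2) + m.choose (b + 2) =
        2 * (m + 1).choose (b + 2) + m.choose b := fun m b ↦ by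
      rw [Nat.choose_succ_succ (m + 1), Nat.choose_succ_succ m (b + 1), Nat.choose_succ_succ m b]
      ring
    rw [tripleWeight, sub_mul, Polynomial.coeff_sub, Polynomial.coeff_sub, h2,
      Polynomial.coeff_C_mul, coeff_tripleWeight n, coeff_tripleWeight (n + 1)]
    rcases a with _ | a
    · simp
      ring
    · rw [Polynomial.coeff_X_mul, coeff_tripleWeight (n + 1) a]
      have e1 := congrArg (Nat.cast : ℕ → R) (h (n + a + 2) (2 * a + 1))
      have e2 := congrArg (Nat.cast : ℕ → R) (h (n + a + 1) (2 * a + 1))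
      push_cast at e1 e2 ⊢
      rw [show n + 2 + (a + 1) + 1 = n + a + 2 + 2 by ring,
        show n + 2 + (a + 1) = n + a + 1 + 2 by ring, show n + 1 + (a + 1) + 1 = n + a + 2 + 1 by ring,
        show n + 1 + (a + 1) = n + a + 1 + 1 by ring, show n + (a + 1) + 1 = n + a + 2 by ring,
        show n + (a + 1) = n + a + 1 by ring, show n + 1 + a + 1 = n + a + 2 by ring,
        show n + 1 + a = n + a + 1 by ring, show 2 * (a + 1) + 1 = 2 * a + 1 + 2 by ring]
      rw [pow_succ]
      linear_combination (-1) ^ a * e1 + (-1) ^ a * e2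

theorem coeff_ten_tripleWeight {n : ℕ} (hn : ¬ 11 ∣ tri n) :
    (tripleWeight (Polynomial.X : Polynomial (ZMod 11)) n).coeff 10 = 0 := by
  have : Fact (Nat.Prime 11) := ⟨by norm_num⟩
  have h2 : 2 * tri n = n * (n + 1) := by exact_mod_cast two_mul_tri n
  have hmod : ¬ 11 ∣ n * (n + 1) := fun h ↦
    hn (Nat.Coprime.dvd_of_dvd_mul_left (by norm_num : Nat.Coprime 11 2) (h2 ▸ h))
  have hmod1 : ¬ 11 ∣ n := fun h ↦ hmod (h.mul_right _)
  have hmod2 : ¬ 11 ∣ n + 1 := fun h ↦ hmod (h.mul_left _)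
  -- Lucas: the last base-11 digit of 21 is 10, so the binomial survives only if `m` also ends in
  -- 10; for `m = n + 11` or `n + 10` this means `n ≡ 10` or `n ≡ 0`.
  have hl : ∀ m : ℕ, m % 11 ≠ 10 → (m.choose 21 : ZMod 11) = 0 := fun m hm ↦ by
    rw [ZMod.natCast_eq_zero_iff, ← Nat.modEq_zero_iff_dvd]
    refine (Choose.choose_modEq_choose_mod_mul_choose_div_nat (p := 11) (n := m) (k := 21)).trans ?_
    rw [Nat.choose_eq_zero_of_lt (by lia), zero_mul]
  rw [coeff_tripleWeight]
  push_cast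
  rw [hl (n + 10 + 1) (by lia), hl (n + 10) (by lia)]
  ring

theorem coeff_genFun_eq_MO {R : Type*} [CommRing R] (a n : ℕ) :
    ((Nat.Partition.genFun fun _ s ↦ (Polynomial.X : Polynomial R) * s).coeff n).coeff a =
      (MO a n : R) := by
  rw [Nat.Partition.coeff_genFun, Polynomial.finsetSum_coeff, MO, Nat.cast_sum, sum_filter]
  refine sum_congr rfl fun p _ ↦ ?_
  rw [Finsupp.prod, prod_mul_distrib, prod_const, Multiset.toFinsupp_support]
  simp only [Multiset.toFinsupp_apply]
  rw [← Nat.cast_prod, ← Polynomial.C_eq_natCast, Polynomial.coeff_mul_C, Polynomial.coeff_X_pow]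
  simp only [eq_comm (a := a), ite_mul, one_mul, zero_mul]

/-- The series `H = E ^ 3 * ∑ MO 10 n * q ^ n` is supported on the multiples of `11`. -/
theorem coeff_pow_three_mul_MO {m : ℕ} (hm : ¬ 11 ∣ m) :
    (pentagonalSeries (ZMod 11) ^ 3 * PowerSeries.mk fun n ↦ (MO 10 n : ZMod 11)).coeff m = 0 := by
  have h := congrArg (fun p ↦ Polynomial.coeff p 10)
    (coeff_genFun_mul_pentagonalSeries (Polynomial.X : Polynomial (ZMod 11)) m)
  have hE : pentagonalSeries (Polynomial (ZMod 11)) =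
      PowerSeries.map Polynomial.C (pentagonalSeries (ZMod 11)) := by
    ext1 d
    rw [coeff_map, ← coeff_eulerProd le_rfl, ← coeff_eulerProd le_rfl, ← coeff_map]
    simp [eulerProd]
  rw [hE, ← map_pow, coeff_mul] at h
  simp only [Polynomial.finsetSum_coeff, coeff_map, Polynomial.coeff_C_mul,
    coeff_genFun_eq_MO] at h
  rw [coeff_mul]
  simp only [coeff_mk]
  rw [h]
  refine sum_eq_zero fun n _ ↦ ?_
  split_ifs with hn
  · rw [← map_one (Polynomial.C (R := ZMod 11)), ← Polynomial.C_neg, ← Polynomial.C_pow,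
      Polynomial.coeff_C_mul, coeff_ten_tripleWeight (by rwa [hn]), mul_zero]
  · simp

theorem mainTheorem6 (n : ℕ) : MO 10 (11 * n + 7) ≡ 0 [MOD 11] := by
  rw [Nat.modEq_zero_iff_dvd, ← ZMod.natCast_eq_zero_iff]
  set E := pentagonalSeries (ZMod 11) with hE
  set G : (ZMod 11)⟦X⟧ := PowerSeries.mk fun n ↦ (MO 10 n : ZMod 11) with hG
  obtain ⟨U, hU⟩ := (isUnit_pentagonalSeries (ZMod 11)).exists_right_inv
  rw [← hE] at hU
  have hfac : G = E ^ 8 * (U ^ 11 * (E ^ 3 * G)) := by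
    have : E ^ 11 * U ^ 11 = 1 := by rw [← mul_pow, hU, one_pow]
    linear_combination -G * this
  have hcoeff : (MO 10 (11 * n + 7) : ZMod 11) = G.coeff (11 * n + 7) := by rw [hG, coeff_mk]
  rw [hcoeff, hfac, coeff_mul]
  refine sum_eq_zero fun x hx ↦ ?_
  rw [HasAntidiagonal.mem_antidiagonal] at hx
  -- Either `x.1 ≡ 7` and the `E^8` factor vanishes, or `x.2 = y.1 + y.2` is not divisible by 11 and
  -- one of the two series in `q^11` contributes zero.
  by_cases h2 : 11 ∣ x.2
  · obtain ⟨c, hc⟩ := h2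
    obtain ⟨d, hd⟩ : ∃ d, x.1 = 11 * d + 7 := ⟨n - c, by lia⟩
    rw [hd, coeff_pentagonalSeries_pow_eight, zero_mul]
  · rw [coeff_mul, sum_eq_zero, mul_zero]
    intro y hy
    rw [HasAntidiagonal.mem_antidiagonal] at hy
    by_cases hy1 : 11 ∣ y.1
    · rw [coeff_pow_three_mul_MO (by lia), mul_zero]
    · rw [coeff_pow_eleven _ hy1, zero_mul]
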